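/- Let $G$ be a first-order structure expanding a group (so the language contains a binary function symbol interpreted in $G$ as the group operation $\cdot$), and let $\mathbb{G}\succ G$ be a monster model of the theory of $G$. A subset $A\subseteq\mathbb{G}$ is called small if $\mathbb{G}$ is $|A|^+$-saturated; $G$ is assumed small. Let $\varphi(x)$ be a formula in one variable with parameters from $G$. A global type $p\in S_1(\mathbb{G})$ is nonalgebraic if it contains no formula with only finitely many solutions. For a small model $M\prec\mathbb{G}$, the type $p$ is $M$-invariant if, for every formula $\theta(x,\bar y)$ over $\emptyset$ and all finite tuples $\bar d,\bar d'$ from $\mathbb{G}$ with $\mathrm{tp}(\bar d/M)=\mathrm{tp}(\bar d'/M)$, one has $\theta(x,\bar d)\in p$ if and only if $\theta(x,\bar d')\in p$. A Morley sequence in $p$ over $M$ is a sequence $(b_i)_{i<\omega}$ with $b_i\models p|_{M\cup\{b_j:j<i\}}$ for all $i<\omega$. The type $p$ is generically stable over $M$ if it is $M$-invariant and, for every Morley sequence $(b_i)_{i<\omega}$ in $p$ over $M$ and every formula $\theta(x)$ with parameters from $\mathbb{G}$, the set $\{i<\omega:\mathbb{G}\models\theta(b_i)\}$ is finite or cofinite.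 The formula $\varphi(x)$ is gs-substantial if there are a small model $M\prec\mathbb{G}$ over which $\varphi(x)$ is defined (i.e. $\varphi(\mathbb{G})$ is definable with parameters from $M$; this holds for instance if $G\subseteq M$ or if $\varphi(x)$ has no parameters) and elements $b,c\in\mathbb{G}\setminus M$ such that $\varphi(b\cdot c)$ holds in $\mathbb{G}$ and $\mathrm{tp}(b/G\cup\{c\})$ extends to a nonalgebraic global type that is generically stable over $M$. Theorem. If $\varphi(x)$ is gs-substantial, then $\varphi(x)$ has the finitary productset property: for every $n\in\mathbb{N}$ there are $B,C\subseteq G$ with $|B|,|C|\ge n$ and $B\cdot C\subseteq\varphi(G)$. -/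

import Mathlib

open FirstOrder FirstOrder.Language
open scoped Pointwise

universe u v w w' x

namespace GSProductset

/-- `θ(x)` with its parameters interpreted through `e` holds at the element `b` of `N`. A formula in
the single variable `x` with parameters from `A` is an element of `L.Formula (A ⊕ Unit)`: the
variables in `A` name the parameters and the variable in `Unit` is `x`. -/
def Holds {L : FirstOrder.Language.{u, v}} {A : Type x} {N : Type w} [L.Structure N]
    (θ : L.Formula (A ⊕ Unit)) (e : A → N) (b : N) : Prop :=
  θ.Realize (Sum.elim e fun _ => b)

/-- `N` is `κ`-saturated: every set `S(x)` of formulas with parameters from a set `A ⊆ N` with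
`|A| < κ` that is finitely satisfiable in `N` is realized in `N`. -/
def IsSaturated (L : FirstOrder.Language.{u, v}) (N : Type w) [L.Structure N] (κ : Cardinal.{w}) : Prop :=
  ∀ A : Set N, Cardinal.mk A < κ → ∀ S : Set (L.Formula (A ⊕ Unit)),
    (∀ S₀ : Set (L.Formula (A ⊕ Unit)), S₀ ⊆ S → S₀.Finite →
      ∃ b : N, ∀ θ ∈ S₀, Holds θ (fun a : A => (a : N)) b) →
    ∃ b : N, ∀ θ ∈ S, Holds θ (fun a : A => (a : N)) b

/-- `A` is a small subset of `N`: `N` is `|A|⁺`-saturated. -/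
def IsSmall (L : FirstOrder.Language.{u, v}) {N : Type w} [L.Structure N] (A : Set N) : Prop :=
  IsSaturated L N (Order.succ (Cardinal.mk A))

/-- The space `S₁(N)` of complete `1`-types over the whole structure `N`: complete types in one
variable over the elementary diagram of `N`. -/
abbrev GlobalType (L : FirstOrder.Language.{u, v}) (N : Type w) [L.Structure N] :=
  (L.elementaryDiagram N).CompleteType Unit

/-- The formula `θ(x)`, with its parameters interpreted through `e`, belongs to the type `p(x)`. -/
def GlobalType.Contains {L : FirstOrder.Language.{u, v}} {N : Type w} [L.Structure N] (p : GlobalType L N)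
    {A : Type x} (θ : L.Formula (A ⊕ Unit)) (e : A → N) : Prop :=
  Formula.equivSentence
    (BoundedFormula.constantsVarsEquiv.symm (θ.relabel (Sum.map e id)) : L[[N]].Formula Unit) ∈ p

/-- `b ⊨ p|_A`. -/
def GlobalType.RealizedOver {L : FirstOrder.Language.{u, v}} {N : Type w} [L.Structure N] (p : GlobalType L N)
    (A : Set N) (b : N) : Prop :=
  ∀ θ : L.Formula (A ⊕ Unit), p.Contains θ (fun a : A => (a : N)) →
    Holds θ (fun a : A => (a : N)) b

/-- `p` extends `tp(b/A)`. -/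
def GlobalType.ExtendsTp {L : FirstOrder.Language.{u, v}} {N : Type w} [L.Structure N] (p : GlobalType L N)
    (b : N) (A : Set N) : Prop :=
  ∀ θ : L.Formula (A ⊕ Unit), Holds θ (fun a : A => (a : N)) b →
    p.Contains θ (fun a : A => (a : N))

/-- `p` contains no formula with only finitely many solutions. -/
def GlobalType.Nonalgebraic {L : FirstOrder.Language.{u, v}} {N : Type w} [L.Structure N]
    (p : GlobalType L N) : Prop :=
  ∀ θ : L.Formula (N ⊕ Unit), p.Contains θ id → {b : N | Holds θ id b}.Infinite

/-- The finite tuples `c` and `c'` have the same complete type over `A`. -/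
def SameTp (L : FirstOrder.Language.{u, v}) {N : Type w} [L.Structure N] (A : Set N) {n : ℕ}
    (c c' : Fin n → N) : Prop :=
  ∀ ψ : L.Formula (A ⊕ Fin n),
    ψ.Realize (Sum.elim (fun a : A => (a : N)) c) ↔ ψ.Realize (Sum.elim (fun a : A => (a : N)) c')

/-- `p` is `A`-invariant: whether `θ(x, c)` belongs to `p` depends only on `θ` and `tp(c/A)`. -/
def GlobalType.Invariant {L : FirstOrder.Language.{u, v}} {N : Type w} [L.Structure N] (p : GlobalType L N)
    (A : Set N) : Prop :=
  ∀ (n : ℕ) (c c' : Fin n → N), SameTp L A c c' →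
    ∀ θ : L.Formula (Fin n ⊕ Unit), p.Contains θ c ↔ p.Contains θ c'

/-- `(b i)` is a Morley sequence in `p` over `A`: `b i ⊨ p|_{A ∪ {b j : j < i}}` for all `i`. -/
def GlobalType.IsMorleySeq {L : FirstOrder.Language.{u, v}} {N : Type w} [L.Structure N] (p : GlobalType L N)
    (A : Set N) (b : ℕ → N) : Prop :=
  ∀ i : ℕ, p.RealizedOver (A ∪ b '' {j | j < i}) (b i)

/-- `p` is generically stable over `A`. -/
def GlobalType.GenericallyStable {L : FirstOrder.Language.{u, v}} {N : Type w} [L.Structure N]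
    (p : GlobalType L N) (A : Set N) : Prop :=
  p.Invariant A ∧
    ∀ b : ℕ → N, p.IsMorleySeq A b → ∀ θ : L.Formula (N ⊕ Unit),
      {i : ℕ | Holds θ id (b i)}.Finite ∨ {i : ℕ | Holds θ id (b i)}ᶜ.Finite

/-- The formula `φ(x)` with parameters from `G ≺ N` (the inclusion being `ι`) is gs-substantial,
where `mul` is the symbol for the group operation. The model `M` is one over which `φ(x)` is
defined, so that `φ(M)` makes sense; it is not required to contain `G`. -/
def IsGSSubstantial {L : FirstOrder.Language.{u, v}} (mul : L.Functions 2) {G : Type w} {N : Type w'}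
    [L.Structure G] [L.Structure N] (ι : G ↪ₑ[L] N) (φ : L.Formula (G ⊕ Unit)) : Prop :=
  ∃ M : L.ElementarySubstructure N, IsSmall L (M : Set N) ∧
    (M : Set N).Definable₁ L {a : N | Holds φ ι a} ∧
    ∃ b c : N, b ∉ M ∧ c ∉ M ∧ Holds φ ι (Structure.funMap mul ![b, c]) ∧
      ∃ p : GlobalType L N,
        p.ExtendsTp b (Set.range ι ∪ {c}) ∧ p.Nonalgebraic ∧ p.GenericallyStable (M : Set N)

/-- The finitary productset property of a subset `A` of a group. -/
def FinitaryProductsetProperty {G : Type w} [Group G] (A : Set G) : Prop :=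
  ∀ n : ℕ, ∃ B C : Set G, (n : ℕ∞) ≤ B.encard ∧ (n : ℕ∞) ≤ C.encard ∧ B * C ⊆ A

end GSProductset

/-! Let D be the set of y with φ(x·y) ∈ p. It contains c, because p extends tp(b/Gc). As φ is
defined over M and p is M-invariant, D is closed under having the same type over M
(`contains_mulRight`). Since c ∉ M and M is small, saturation gives tp(c/M) infinitely many
realizations (`exists_realization_notMem`), so D is infinite. Choose n distinct points of D. The
corresponding n formulas lie in p, which is nonalgebraic, so they have infinitely many common
solutions. This yields an n × n rectangle in the monster model. Its existence is a first-order
statement over G, hence true in G. -/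

namespace GSProductset

section

variable {L : FirstOrder.Language.{u, v}} {N : Type w} [L.Structure N]

/-! ### Global types and logical consequence -/

/-- A global type is realized in an elementary extension. -/
theorem GlobalType.exists_realization (p : GlobalType L N) :
    ∃ (K : Type (max u v w)) (_ : L.Structure K) (j : N ↪ₑ[L] K) (a : K),
      ∀ θ : L.Formula (N ⊕ Unit),
        Formula.equivSentence
          (BoundedFormula.constantsVarsEquiv.symm θ : L[[N]].Formula Unit) ∈ p ↔ Holds θ j a := by
  obtain ⟨K, a, rfl⟩ := Theory.exists_modelType_is_realized_in _ p
  let : L.Structure K := (L.lhomWithConstants N).reduct K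
  have : (L.lhomWithConstants N).IsExpansionOn K := LHom.isExpansionOn_reduct _ _
  refine ⟨K, inferInstance, ElementaryEmbedding.ofModelsElementaryDiagram L N K, a (), fun θ => ?_⟩
  rw [Theory.CompleteType.formula_mem_typeOf, Formula.Realize,
    ← BoundedFormula.realize_constantsVarsEquiv, Equiv.apply_symm_apply]
  rfl

/-- A global type contains every consequence of finitely many of its formulas. -/
theorem GlobalType.contains_of_forall (p : GlobalType L N) {κ : Type*} {A : Type x} {B : Type w'}
    [Finite κ] {θ : κ → L.Formula (A ⊕ Unit)} {e : κ → A → N} {θ' : L.Formula (B ⊕ Unit)}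
    {e' : B → N} (h : ∀ k, p.Contains (θ k) (e k))
    (hθ : ∀ b, (∀ k, Holds (θ k) (e k) b) → Holds θ' e' b) :
    p.Contains θ' e' := by
  obtain ⟨K, _, j, a, hj⟩ := p.exists_realization
  -- The universal closure of this implication holds in `N`, hence in the elementary extension where
  -- `a` realizes `p`.
  let χ : L.Formula (N ⊕ Unit) := (Formula.iInf fun k => (θ k).relabel (Sum.map (e k) id)).imp
    (θ'.relabel (Sum.map e' id))
  have hχ : (χ.iAlls Unit).Realize (id : N → N) := by
    rw [Formula.realize_iAlls]
    intro i
    simp only [χ, Formula.realize_imp, Formula.realize_iInf, Formula.realize_relabel,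
      Sum.elim_comp_map]
    exact hθ (i ())
  rw [← j.map_formula, Formula.realize_iAlls] at hχ
  have := hχ fun _ => a
  simp only [χ, Formula.realize_imp, Formula.realize_iInf] at this
  exact (hj _).2 (this fun k => (hj _).1 (h k))

/-- Finitely many formulas in a nonalgebraic type have infinitely many common solutions. -/
theorem GlobalType.Nonalgebraic.infinite_setOf_forall {p : GlobalType L N} (hp : p.Nonalgebraic)
    {κ : Type*} {A : Type x} [Finite κ] {θ : κ → L.Formula (A ⊕ Unit)} {e : κ → A → N}
    (h : ∀ k, p.Contains (θ k) (e k)) : {b : N | ∀ k, Holds (θ k) (e k) b}.Infinite := by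
  have key : ∀ b, Holds (Formula.iInf fun k => (θ k).relabel (Sum.map (e k) id)) id b ↔
      ∀ k, Holds (θ k) (e k) b := fun b => by
    simp only [Holds, Formula.realize_iInf, Formula.realize_relabel, Sum.elim_comp_map,
      Function.comp_id, Function.id_comp]
  simpa only [key] using hp _ (p.contains_of_forall h fun b => (key b).2)

/-! ### Realizations outside finite sets -/

/-- A formula over an elementary substructure `M` with a solution outside `M` has a solution in `M`
avoiding any given finite set. -/
theorem exists_holds_notMem (M : L.ElementarySubstructure N) {κ : Type*} [Finite κ]
    (θ : κ → L.Formula (M ⊕ Unit)) {c : N} (hc : c ∉ M) 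
    (h : ∀ k, Holds (θ k) (fun m : M => (m : N)) c) (F : Finset N) :
    ∃ b ∈ M, b ∉ F ∧ ∀ k, Holds (θ k) (fun m : M => (m : N)) b := by
  have hF : Finite {m : M // (m : N) ∈ F} :=
    (F.finite_toSet.preimage Subtype.val_injective.injOn).to_subtype
  -- Only the points of `F` in `M` are excluded: these are the available parameters, and the witness
  -- will lie in `M`.
  let χ : L.Formula (M ⊕ Unit) := (Formula.iInf θ) ⊓
    Formula.iInf fun m : {m : M // (m : N) ∈ F} =>
      ((Term.var (Sum.inl m.1)).equal (Term.var (Sum.inr ()))).not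
  have hχ : (χ.iExs Unit).Realize (fun m : M => (m : N)) := by
    rw [Formula.realize_iExs]
    refine ⟨fun _ => c, ?_⟩
    simp only [χ, Formula.realize_inf, Formula.realize_iInf, Formula.realize_not,
      Formula.realize_equal, Term.realize_var, Sum.elim_inl, Sum.elim_inr]
    exact ⟨h, fun m (hm : (m.1 : N) = c) => hc (hm ▸ m.1.2)⟩
  have hχ' : (χ.iExs Unit).Realize (id : M → M) :=
    (M.subtype.map_formula (χ.iExs Unit) id).1 hχ
  rw [Formula.realize_iExs] at hχ'
  obtain ⟨i, hi⟩ := hχ'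
  simp only [χ, Formula.realize_inf, Formula.realize_iInf, Formula.realize_not,
    Formula.realize_equal, Term.realize_var, Sum.elim_inl, Sum.elim_inr] at hi
  refine ⟨i (), (i ()).2, fun hb => hi.2 ⟨i (), hb⟩ rfl, fun k => ?_⟩
  have := (M.subtype.map_formula (θ k) _).2 (hi.1 k)
  rw [Sum.comp_elim] at this
  exact this

/-- Over a small model `M`, a type realized outside `M` is realized outside any given
finite set. -/
theorem exists_realization_notMem (M : L.ElementarySubstructure N)
    (hM : IsSmall L (M : Set N)) {c : N} (hc : c ∉ M) (F : Finset N) :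
    ∃ c' ∉ F, ∀ θ : L.Formula (M ⊕ Unit),
      Holds θ (fun m : M => (m : N)) c → Holds θ (fun m : M => (m : N)) c' := by
  classical
  -- If `M` were finite, the empty family of formulas with `F = M` would give a point of `M` outside
  -- `M`. Infinity of `M` keeps `M ∪ F` within the saturation bound.
  have : Infinite M := Set.infinite_coe_iff.2 fun hfin => by
    obtain ⟨b, hb, hbF, -⟩ := exists_holds_notMem M (κ := Empty) nofun hc nofun hfin.toFinset
    exact hbF (hfin.mem_toFinset.2 hb)
  let A : Set N := M ∪ F
  have hA : Cardinal.mk A < Order.succ (Cardinal.mk (M : Set N)) := by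
    refine Order.lt_succ_of_le ((Cardinal.mk_union_le _ _).trans ?_)
    have : Cardinal.aleph0 ≤ Cardinal.mk (M : Set N) := Cardinal.aleph0_le_mk M
    exact Cardinal.add_le_of_le this le_rfl (Cardinal.mk_le_aleph0.trans this)
  let f : M → A := fun m => ⟨m, Or.inl m.2⟩
  let S₁ : Set (L.Formula (A ⊕ Unit)) :=
    (fun θ : L.Formula (M ⊕ Unit) => θ.relabel (Sum.map f id)) ''
      {θ | Holds θ (fun m : M => (m : N)) c}
  let S₂ : Set (L.Formula (A ⊕ Unit)) :=
    (fun a : A => ((Term.var (Sum.inl a)).equal (Term.var (Sum.inr ()))).not) '' {a | (a : N) ∈ F}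
  have h₁ : ∀ (θ : L.Formula (M ⊕ Unit)) (b : N),
      Holds (θ.relabel (Sum.map f id)) (fun a : A => (a : N)) b ↔
        Holds θ (fun m : M => (m : N)) b := fun θ b => by
    simp only [Holds, Formula.realize_relabel, Sum.elim_comp_map, Function.comp_id]
    rfl
  have h₂ : ∀ (a : A) (b : N),
      Holds (((Term.var (Sum.inl a)).equal (Term.var (Sum.inr ()))).not : L.Formula (A ⊕ Unit))
        (fun a : A => (a : N)) b ↔ (a : N) ≠ b := fun a b => by
    simp [Holds]
  obtain ⟨c', hc'⟩ := hM A hA (S₁ ∪ S₂) fun S₀ hS hfin => by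
    have : Finite ↥(S₀ ∩ S₁) := hfin.inter_of_left S₁
    choose g hg hgS using fun k : ↥(S₀ ∩ S₁) => k.2.2
    obtain ⟨b, -, hbF, hb⟩ := exists_holds_notMem M g hc hg F
    refine ⟨b, fun θ hθ => ?_⟩
    rcases hS hθ with hθ' | ⟨a, ha, rfl⟩
    · rw [← show _ = θ from hgS ⟨θ, hθ, hθ'⟩]
      exact (h₁ _ b).2 (hb _)
    · exact (h₂ a b).2 fun hab => hbF (hab ▸ ha)
  refine ⟨c', fun hF => ?_, fun θ hθ => (h₁ θ c').1 (hc' _ (Or.inl ⟨θ, hθ, rfl⟩))⟩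
  exact (h₂ ⟨c', Or.inr hF⟩ c').1 (hc' _ (Or.inr ⟨_, hF, rfl⟩)) rfl

/-! ### Invariance of the set D -/

/-- The formula `φ(x · y)`, where `x` is the variable of `φ` and `y` is a new parameter. -/
def mulRight (mul : L.Functions 2) {A : Type x} (φ : L.Formula (A ⊕ Unit)) :
    L.Formula ((A ⊕ Unit) ⊕ Unit) :=
  BoundedFormula.subst φ (Sum.elim (fun a => Term.var (Sum.inl (Sum.inl a))) fun _ =>
    mul.apply₂ (Term.var (Sum.inr ())) (Term.var (Sum.inl (Sum.inr ()))))

theorem holds_mulRight (mul : L.Functions 2) {A : Type x} (φ : L.Formula (A ⊕ Unit)) (e : A → N)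
    (b y : N) : Holds (mulRight mul φ) (Sum.elim e fun _ => y) b ↔
      Holds φ e (Structure.funMap mul ![b, y]) := by
  rw [Holds, Holds, mulRight, Formula.Realize, BoundedFormula.realize_subst, Formula.Realize]
  refine iff_of_eq (congrArg (fun w => BoundedFormula.Realize φ w _) (funext fun a => ?_))
  rcases a with a | a <;> simp

/-- If `p` is `M`-invariant and `φ` is defined over `M`, then whether `φ(x · y)` belongs to `p`
depends only on the type of `y` over `M`. -/
theorem GlobalType.Invariant.contains_mulRight {p : GlobalType L N} {M : Set N}
    (hp : p.Invariant M) (mul : L.Functions 2) {A : Type x} {φ : L.Formula (A ⊕ Unit)} {e : A → N}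
    (hφ : M.Definable₁ L {a | Holds φ e a}) {c c' : N}
    (hc : ∀ θ : L.Formula (M ⊕ Unit),
      Holds θ (fun m : M => (m : N)) c → Holds θ (fun m : M => (m : N)) c')
    (h : p.Contains (mulRight mul φ) (Sum.elim e fun _ => c)) :
    p.Contains (mulRight mul φ) (Sum.elim e fun _ => c') := by
  -- Invariance concerns finite tuples, so φ is rewritten with finitely many parameters from `M`; `t
  -- y` lists them with `y` appended.
  obtain ⟨A₀, hA₀, hdef⟩ := Set.definable_iff_finitely_definable.1 hφ
  obtain ⟨ψ, hψ⟩ := Set.definable_iff_exists_formula_sum.1 hdef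
  have hψ' : ∀ a : N, Holds φ e a ↔
      ψ.Realize (Sum.elim (fun m : (A₀ : Set N) => (m : N)) fun _ => a) := fun a =>
    Set.ext_iff.1 hψ fun _ => a
  obtain ⟨k, ⟨r⟩⟩ := Finite.exists_equiv_fin (A₀ : Set N)
  let t : N → Fin (k + 1) → N := fun y => Fin.snoc (fun i => (r.symm i : N)) y
  let χ : L.Formula (Fin (k + 1) ⊕ Unit) :=
    BoundedFormula.subst ψ (Sum.elim (fun a => Term.var (Sum.inl (r a).castSucc)) fun _ =>
      mul.apply₂ (Term.var (Sum.inr ())) (Term.var (Sum.inl (Fin.last k))))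
  have hχ : ∀ b y : N, Holds χ (t y) b ↔ Holds (mulRight mul φ) (Sum.elim e fun _ => y) b := by
    intro b y
    rw [holds_mulRight, hψ', Holds, Formula.Realize, BoundedFormula.realize_subst, Formula.Realize]
    refine iff_of_eq (congrArg (fun w => BoundedFormula.Realize ψ w _) (funext fun a => ?_))
    rcases a with a | a <;> simp [t]
  have himp : ∀ θ : L.Formula (M ⊕ Fin (k + 1)),
      θ.Realize (Sum.elim (fun a : M => (a : N)) (t c)) →
        θ.Realize (Sum.elim (fun a : M => (a : N)) (t c')) := by
    intro θ
    -- All coordinates of `t y` but the last are in `M`, so a formula about `t y` is a formula about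
    -- `y` over `M`.
    let s : M ⊕ Fin (k + 1) → M ⊕ Unit := Sum.elim Sum.inl
      (Fin.snoc (α := fun _ => M ⊕ Unit) (fun i => Sum.inl ⟨r.symm i, hA₀ (r.symm i).2⟩) (Sum.inr ()))
    have hs : ∀ y : N, Holds (θ.relabel s) (fun m : M => (m : N)) y ↔
        θ.Realize (Sum.elim (fun a : M => (a : N)) (t y)) := fun y => by
      rw [Holds, Formula.realize_relabel]
      refine iff_of_eq (congrArg θ.Realize (funext fun a => ?_))
      rcases a with a | i
      · rfl
      · induction i using Fin.lastCases <;> simp [s, t]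
    rw [← hs, ← hs]
    exact hc _
  have hsame : SameTp L M (t c) (t c') := fun θ =>
    ⟨himp θ, fun hθ => by_contra fun hn => himp θ.not hn hθ⟩
  have h' := (hp _ _ _ hsame χ).1 (p.contains_of_forall (κ := Unit) (fun _ => h)
    fun b hb => (hχ b c).2 (hb ()))
  exact p.contains_of_forall (κ := Unit) (fun _ => h') fun b hb => (hχ b c').1 (hb ())

/-! ### Rectangles and transfer to G -/

/-- The formula expressing that `φ(x i · y j)` holds for all `i`, `j`, where the `x i` are distinct
and the `y j` are distinct. -/
noncomputable def rectangle (mul : L.Functions 2) {A : Type x} (φ : L.Formula (A ⊕ Unit)) (n : ℕ) :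
    L.Formula (A ⊕ (Fin n ⊕ Fin n)) :=
  (Formula.iInf fun q : {q : Fin n × Fin n // q.1 ≠ q.2} =>
    ((Term.var (Sum.inr (Sum.inl q.1.1))).equal (Term.var (Sum.inr (Sum.inl q.1.2)))).not) ⊓
  ((Formula.iInf fun q : {q : Fin n × Fin n // q.1 ≠ q.2} =>
    ((Term.var (Sum.inr (Sum.inr q.1.1))).equal (Term.var (Sum.inr (Sum.inr q.1.2)))).not) ⊓
  Formula.iInf fun q : Fin n × Fin n => BoundedFormula.subst φ
    (Sum.elim (fun a => Term.var (Sum.inl a)) fun _ =>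
      mul.apply₂ (Term.var (Sum.inr (Sum.inl q.1))) (Term.var (Sum.inr (Sum.inr q.2)))))

theorem realize_rectangle (mul : L.Functions 2) {A : Type x} (φ : L.Formula (A ⊕ Unit)) (n : ℕ)
    (e : A → N) (i : Fin n ⊕ Fin n → N) :
    (rectangle mul φ n).Realize (Sum.elim e i) ↔
      (i ∘ Sum.inl).Injective ∧ (i ∘ Sum.inr).Injective ∧
        ∀ j k, Holds φ e (Structure.funMap mul ![i (Sum.inl j), i (Sum.inr k)]) := by
  have hinj : ∀ f : Fin n → N, (∀ q : {q : Fin n × Fin n // q.1 ≠ q.2}, f q.1.1 ≠ f q.1.2) ↔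
      f.Injective := fun f =>
    ⟨fun h a b hab => by_contra fun hne => h ⟨(a, b), hne⟩ hab, fun h q => h.ne q.2⟩
  have hsub : ∀ q : Fin n × Fin n, Formula.Realize (BoundedFormula.subst φ
      (Sum.elim (fun a => Term.var (Sum.inl a)) fun _ =>
        mul.apply₂ (Term.var (Sum.inr (Sum.inl q.1))) (Term.var (Sum.inr (Sum.inr q.2)))))
      (Sum.elim e i) ↔
      Holds φ e (Structure.funMap mul ![i (Sum.inl q.1), i (Sum.inr q.2)]) := fun q => by
    rw [Holds, Formula.Realize, BoundedFormula.realize_subst, Formula.Realize]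
    refine iff_of_eq (congrArg (fun w => BoundedFormula.Realize φ w _) (funext fun a => ?_))
    rcases a with a | a <;> simp
  rw [rectangle, Formula.realize_inf, Formula.realize_inf, ← hinj, ← hinj]
  simp only [Formula.realize_iInf, Formula.realize_not, Formula.realize_equal, Term.realize_var,
    Sum.elim_inr, hsub, Prod.forall, Function.comp_apply, ne_eq]

end

end GSProductset

open GSProductset in
theorem mainTheorem10 {L : FirstOrder.Language.{u, v}} (mul : L.Functions 2)
    {G : Type w} [Group G] [L.Structure G]
    (hmul : ∀ g h : G, Structure.funMap mul ![g, h] = g * h)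
    {N : Type w'} [L.Structure N] (ι : G ↪ₑ[L] N)
    (hsmall : GSProductset.IsSmall L (Set.range ι))
    (φ : L.Formula (G ⊕ Unit)) (hφ : GSProductset.IsGSSubstantial mul ι φ) :
    GSProductset.FinitaryProductsetProperty {g : G | GSProductset.Holds φ id g} := by
  obtain ⟨M, hM, hdef, b, c, -, hc, hbc, p, hext, hna, hinv, -⟩ := hφ
  have hpc : p.Contains (mulRight mul φ) (Sum.elim ι fun _ => c) := by
    let r : G ⊕ Unit → ↥(Set.range ι ∪ {c}) :=
      Sum.elim (fun g => ⟨ι g, Or.inl ⟨g, rfl⟩⟩) fun _ => ⟨c, Or.inr rfl⟩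
    have hr : (fun a : ↥(Set.range ι ∪ {c}) => (a : N)) ∘ r = Sum.elim ι fun _ => c := by
      funext a
      rcases a with a | a <;> rfl
    have hh : ∀ a, Holds ((mulRight mul φ).relabel (Sum.map r id))
        (fun a : ↥(Set.range ι ∪ {c}) => (a : N)) a ↔
          Holds (mulRight mul φ) (Sum.elim ι fun _ => c) a := fun a => by
      rw [Holds, Formula.realize_relabel, Sum.elim_comp_map, hr, Function.comp_id, Holds]
    exact p.contains_of_forall (κ := Unit)
      (fun _ => hext _ ((hh b).2 ((holds_mulRight ..).2 hbc))) fun a ha => (hh a).1 (ha ())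
  have hD : {y : N | p.Contains (mulRight mul φ) (Sum.elim ι fun _ => y)}.Infinite := fun hfin => by
    obtain ⟨c', hc'F, hc'⟩ := exists_realization_notMem M hM hc hfin.toFinset
    exact hc'F (hfin.mem_toFinset.2 (hinv.contains_mulRight mul hdef hc' hpc))
  intro n
  let y : Fin n → N := fun j => hD.natEmbedding _ j
  have hy : y.Injective := fun j k hjk =>
    Fin.ext ((hD.natEmbedding _).injective (Subtype.ext hjk))
  have hX := hna.infinite_setOf_forall fun j : Fin n => (hD.natEmbedding _ j).2
  let z : Fin n → N := fun i => hX.natEmbedding _ i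
  have hz : z.Injective := fun j k hjk =>
    Fin.ext ((hX.natEmbedding _).injective (Subtype.ext hjk))
  have hzy : ∀ i j, Holds φ ι (Structure.funMap mul ![z i, y j]) := fun i j =>
    (holds_mulRight ..).1 ((hX.natEmbedding _ i).2 j)
  -- Once `z` and `y` are quantified away, only parameters from `G` remain, so elementarity of `ι`
  -- applies.
  have hN : ((rectangle mul φ n).iExs (Fin n ⊕ Fin n)).Realize (ι ∘ id) :=
    Formula.realize_iExs.2 ⟨Sum.elim z y, (realize_rectangle ..).2 ⟨hz, hy, hzy⟩⟩
  obtain ⟨i, hi⟩ := Formula.realize_iExs.1 ((ι.map_formula _ _).1 hN)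
  obtain ⟨hB, hC, hBC⟩ := (realize_rectangle ..).1 hi
  have hcard : ∀ f : Fin n → G, f.Injective → (n : ℕ∞) ≤ (Set.range f).encard := fun f hf => by
    rw [← Set.image_univ, hf.encard_image, Set.encard_univ, ENat.card_eq_coe_fintype_card,
      Fintype.card_fin]
  refine ⟨_, _, hcard _ hB, hcard _ hC, ?_⟩
  rintro _ ⟨_, ⟨j, rfl⟩, _, ⟨k, rfl⟩, rfl⟩
  have := hBC j k
  rwa [hmul] at this
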